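/- Let $G$ be a group and let $G^{\varphi}$ be an isomorphic copy of $G$ via $g\mapsto g^{\varphi}$. Let \[\chi(G)=\langle G\cup G^{\varphi}\mid [g,g^{\varphi}]=1\ \text{for all } g\in G\rangle\] be the weak commutativity group of $G$, that is, the quotient of the free product $G*G^{\varphi}$ by the normal closure of all $[g,g^{\varphi}]$, $g\in G$. In $\chi(G)$ let $L(G)=\langle g^{-1}g^{\varphi}\mid g\in G\rangle$ and $R(G)=[[G,L(G)],G^{\varphi}]$. For a group $H$ let $\exp(H)$ be the least positive integer $n$ with $h^n=1$ for all $h\in H$, if there is one, and $\exp(H)=0$ otherwise (so that divisibility of $0$ is no condition). Let $p$ be a prime and let $G$ be a (not necessarily finite) $p$-group, i.e. every element of $G$ has $p$-power order. Suppose that $G$ is solvable of derived length $d$, and let $G'$ be its derived subgroup. If $p=2$, then $\exp(R(G))$ divides both $\exp(G')\cdot\exp(G)$ and $2^d\cdot\exp(G')^{d-1}$. If $p>2$, then $\exp(R(G))$ divides both $\exp(G')\cdot\exp(G)$ and $\exp(G')^{d-1}$. (For trivial $G$, where $d=0$ and $\exp(G')=1$, read $\exp(G')^{d-1}$ as $1$.)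 In particular, when $\exp(G)$ is finite, \[\exp(R(G))\ \Big|\ \begin{cases}\min\{\exp(G')\cdot\exp(G),\ 2^d\cdot\exp(G')^{d-1}\}, & p=2,\\ \min\{\exp(G')\cdot\exp(G),\ \exp(G')^{d-1}\}, & p>2,\end{cases}\] which is then equivalent to the above, all these numbers being powers of $p$. -/

import Mathlib

namespace WeakCommutativity

open scoped commutatorElement

/-- The weak commutativity group (the double Sidki of `G`)
`χ(G) = ⟨G ∪ G^φ ∣ [g, g^φ] = 1 for all g ∈ G⟩`: the quotient of the free product of two copies of
`G` (the left one is `G`, the right one is `G^φ`) by the normal closure of the commutators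
`[g, g^φ]`. -/
abbrev Chi (G : Type*) [Group G] : Type _ :=
  Monoid.Coprod G G ⧸
    Subgroup.normalClosure
      (Set.range fun g : G =>
        ⁅(Monoid.Coprod.inl g : Monoid.Coprod G G), (Monoid.Coprod.inr g : Monoid.Coprod G G)⁆)

variable (G : Type*) [Group G]

/-- The canonical map `G → χ(G)`, `g ↦ g`. -/
def ofLeft : G →* Chi G :=
  (QuotientGroup.mk' _).comp Monoid.Coprod.inl

/-- The canonical map `G → χ(G)`, `g ↦ g^φ`. -/
def ofRight : G →* Chi G :=
  (QuotientGroup.mk' _).comp Monoid.Coprod.inr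

/-- `L(G) = ⟨g⁻¹ g^φ ∣ g ∈ G⟩`. -/
def L : Subgroup (Chi G) :=
  Subgroup.closure (Set.range fun g : G => (ofLeft G g)⁻¹ * ofRight G g)

/-- `R(G) = [G, L(G), G^φ] = [[G, L(G)], G^φ]`. -/
def R : Subgroup (Chi G) :=
  ⁅⁅(ofLeft G).range, L G⁆, (ofRight G).range⁆

/-- `G` is solvable with derived length `d`: `d` is the least `n` for which the `n`-th term of the
derived series (`G^(0) = G`, `G^(n+1) = [G^(n), G^(n)]`) is trivial. -/
def HasDerivedLength (d : ℕ) : Prop :=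
  IsLeast {n : ℕ | derivedSeries G n = ⊥} d

end WeakCommutativity

/-! Write e = exp(G'). `D G` and `L G` centralise each other, so `W G`, which lies in both, is
abelian and centralised by `L G`. As `[G, L(G)] ≤ P(G)` and `[P(G), G^φ] ≤ W(G)`, `R G` is an
abelian group generated by the elements `[x, h^φ]` with x in `P G`, and only these need bounding for
the first estimate.

First estimate: `W G` is also centralised by both copies of G', so `[x, h^φ]^e` depends on h only up
to conjugacy. With x the defect of (a, b), this e-th power is alternating in (a, b, h). Hence h^φ
fixes `[x, h^φ]^e`, which makes h^m ↦ `[x, (h^m)^φ]^e` multiplicative in m, and m = exp(G) finishes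
(`commutator_right_pow_mul_eq_one`).

Second estimate: modulo `[P, L]` the map (g, k) ↦ `[g, k^φ k⁻¹]` is a biderivation vanishing on the
diagonal, which forces `R^2 ≤ [P, L]`, and `R ≤ [P, L]` for odd p. Descending the derived series of
`P G`, each factor `[P_k, L]/[P_{k+1}, L]` is killed by m = 2e, or by m = e for odd p: this is a
class-two power computation, using that e-th powers of `P G` lie in `W G`. Since `P G` projects into
G' with kernel `W G`, d - 1 steps reach the trivial group. -/

namespace WeakCommutativity

open scoped commutatorElement

/-! ### Commutator identities for two homomorphisms with pointwise commuting values. -/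

section Pair

variable {G X : Type*} [Group G] [Group X] {i j : G →* X}

/-- This is the defining relation at `a⁻¹ * b`, expanded using those at `a` and `b`. -/
theorem commutator_left_right_eq (hij : ∀ g, Commute (i g) (j g)) (a b : G) :
    ⁅i a, j b⁆ = ⁅j a, i b⁆ := by
  have h := (hij (a⁻¹ * b)).eq
  have h1 := (hij a).eq
  have h2 := (hij b).eq
  simp only [map_mul, map_inv] at h
  simp only [commutatorElement_def]
  have h3 : i b * (j a)⁻¹ * j b = i a * ((j a)⁻¹ * j b * ((i a)⁻¹ * i b)) := by
    rw [← h]; group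
  have h4 : i b * (j a)⁻¹ * (i b)⁻¹ = (j a)⁻¹ * (i a * j b * (i a)⁻¹ * (j b)⁻¹) := by
    have h5 : i a * (j a)⁻¹ = (j a)⁻¹ * i a := (hij a).inv_right.eq
    calc i b * (j a)⁻¹ * (i b)⁻¹ = (i b * (j a)⁻¹ * j b) * (i b * j b)⁻¹ := by group
      _ = (i a * (j a)⁻¹) * j b * (i a)⁻¹ * i b * (i b * j b)⁻¹ := by rw [h3]; group
      _ = _ := by rw [h5, h2]; group
  calc i a * j b * (i a)⁻¹ * (j b)⁻¹ = j a * ((j a)⁻¹ * (i a * j b * (i a)⁻¹ * (j b)⁻¹)) := by group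
    _ = _ := by rw [← h4]; group

/-- Expand both sides of `commutator_left_right_eq` at `a` and `k * b`, then cancel the factors that
agree. -/
theorem conj_commutator_left_eq_right (hij : ∀ g, Commute (i g) (j g)) (a b k : G) :
    i k * ⁅i a, j b⁆ * (i k)⁻¹ = j k * ⁅i a, j b⁆ * (j k)⁻¹ := by
  have h := commutator_left_right_eq hij a (k * b)
  have e1 : ⁅i a, j (k * b)⁆ = ⁅i a, j k⁆ * (j k * ⁅i a, j b⁆ * (j k)⁻¹) := by
    rw [map_mul]; simp only [commutatorElement_def]; group
  have e2 : ⁅j a, i (k * b)⁆ = ⁅j a, i k⁆ * (i k * ⁅j a, i b⁆ * (i k)⁻¹) := by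
    rw [map_mul]; simp only [commutatorElement_def]; group
  rw [e1, e2, ← commutator_left_right_eq hij a k, ← commutator_left_right_eq hij a b] at h
  exact (mul_left_cancel h).symm

theorem commutator_right_left_inv (hij : ∀ g, Commute (i g) (j g)) (a b : G) :
    ⁅i b, j a⁆ = ⁅i a, j b⁆⁻¹ := by
  rw [commutatorElement_inv, ← commutator_left_right_eq hij b a]

theorem conj_left_commutator (a b k : G) :
    i k * ⁅i a, j b⁆ * (i k)⁻¹ = ⁅i (k * a), j b⁆ * ⁅i k, j b⁆⁻¹ := by
  rw [map_mul]; simp only [commutatorElement_def]; group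

end Pair

/-! ### The normal subgroups D, L, P, W of χ(G). -/

section Chi

variable {G : Type*} [Group G]

theorem commute_ofLeft_ofRight (g : G) : Commute (ofLeft G g) (ofRight G g) := by
  rw [← commutatorElement_eq_one_iff_commute]
  have : ⁅ofLeft G g, ofRight G g⁆ = QuotientGroup.mk' _
      ⁅(Monoid.Coprod.inl g : Monoid.Coprod G G), (Monoid.Coprod.inr g : Monoid.Coprod G G)⁆ := by
    rw [map_commutatorElement]; rfl
  rw [this]
  exact (QuotientGroup.eq_one_iff _).2 (Subgroup.subset_normalClosure ⟨g, rfl⟩)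

theorem chi_induction {q : Chi G → Prop} (hl : ∀ g, q (ofLeft G g)) (hr : ∀ g, q (ofRight G g))
    (hm : ∀ x y, q x → q y → q (x * y)) (x : Chi G) : q x := by
  obtain ⟨y, rfl⟩ := QuotientGroup.mk_surjective x
  induction y using Monoid.Coprod.induction_on with
  | inl g => exact hl g
  | inr g => exact hr g
  | mul a b ha hb => exact hm _ _ ha hb

theorem chi_hom_ext {H : Type*} [Group H] {f f' : Chi G →* H}
    (hl : ∀ g, f (ofLeft G g) = f' (ofLeft G g)) (hr : ∀ g, f (ofRight G g) = f' (ofRight G g))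
    (x : Chi G) : f x = f' x :=
  chi_induction (q := fun x => f x = f' x) hl hr (fun x y hx hy => by rw [map_mul, map_mul, hx, hy]) x

/-- The homomorphism out of `χ(G)` given by two homomorphisms with commuting values at each `g`. -/
def lift {H : Type*} [Group H] (f f' : G →* H) (hc : ∀ g, Commute (f g) (f' g)) : Chi G →* H :=
  QuotientGroup.lift _ (Monoid.Coprod.lift f f') (by
    refine Subgroup.normalClosure_le_normal ?_
    rintro _ ⟨g, rfl⟩
    simp only [SetLike.mem_coe, MonoidHom.mem_ker, map_commutatorElement, Monoid.Coprod.lift_apply_inl,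
      Monoid.Coprod.lift_apply_inr]
    exact (commutatorElement_eq_one_iff_commute).2 (hc g))

@[simp] theorem lift_ofLeft {H : Type*} [Group H] (f f' : G →* H) (hc) (g : G) :
    lift f f' hc (ofLeft G g) = f g := by
  simp [lift, ofLeft]

@[simp] theorem lift_ofRight {H : Type*} [Group H] (f f' : G →* H) (hc) (g : G) :
    lift f f' hc (ofRight G g) = f' g := by
  simp [lift, ofRight]

variable (G)

/-- The retraction `χ(G) → G` that identifies both copies with `G`. -/
def fold : Chi G →* G := lift (MonoidHom.id G) (MonoidHom.id G) fun g => Commute.refl g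

/-- The projection of `χ(G)` to its left copy. -/
def projLeft : Chi G →* G := lift (MonoidHom.id G) 1 fun _ => Commute.one_right _

/-- The projection of `χ(G)` to its right copy. -/
def projRight : Chi G →* G := lift 1 (MonoidHom.id G) fun _ => Commute.one_left _

/-- `D(G) = [G, G^φ]`. -/
def D : Subgroup (Chi G) := ⁅(ofLeft G).range, (ofRight G).range⁆

/-- The kernel in `L(G)` of the projection to the right copy. -/
def P : Subgroup (Chi G) := (fold G).ker ⊓ (projRight G).ker

/-- The common kernel of the folding map and the two projections. -/
def W : Subgroup (Chi G) := P G ⊓ (projLeft G).ker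

instance : (P G).Normal := by unfold P; infer_instance

instance : (W G).Normal := by unfold W; infer_instance

variable {G}

@[simp] theorem fold_ofLeft (g : G) : fold G (ofLeft G g) = g := lift_ofLeft ..
@[simp] theorem fold_ofRight (g : G) : fold G (ofRight G g) = g := lift_ofRight ..
@[simp] theorem projLeft_ofLeft (g : G) : projLeft G (ofLeft G g) = g := lift_ofLeft ..
@[simp] theorem projLeft_ofRight (g : G) : projLeft G (ofRight G g) = 1 := lift_ofRight ..
@[simp] theorem projRight_ofLeft (g : G) : projRight G (ofLeft G g) = 1 := lift_ofLeft ..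
@[simp] theorem projRight_ofRight (g : G) : projRight G (ofRight G g) = g := lift_ofRight ..

theorem commutator_mem_D (a b : G) : ⁅ofLeft G a, ofRight G b⁆ ∈ D G :=
  Subgroup.commutator_mem_commutator ⟨a, rfl⟩ ⟨b, rfl⟩

theorem D_induction {q : Chi G → Prop} (hd : ∀ a b, q ⁅ofLeft G a, ofRight G b⁆) (h1 : q 1)
    (hm : ∀ x ∈ D G, ∀ y ∈ D G, q x → q y → q (x * y)) (hi : ∀ x ∈ D G, q x → q x⁻¹)
    {x : Chi G} (hx : x ∈ D G) : q x := by
  have hx' := hx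
  rw [D, Subgroup.commutator_def] at hx'
  induction hx' using Subgroup.closure_induction with
  | mem y hy =>
    obtain ⟨_, ⟨a, rfl⟩, _, ⟨b, rfl⟩, rfl⟩ := hy
    exact hd a b
  | one => exact h1
  | mul x y hx' hy' ihx ihy => exact hm x hx' y hy' (ihx hx') (ihy hy')
  | inv x hx' ih => exact hi x hx' (ih hx')

theorem conj_left_eq_conj_right_of_mem_D {u : Chi G} (hu : u ∈ D G) (k : G) :
    ofLeft G k * u * (ofLeft G k)⁻¹ = ofRight G k * u * (ofRight G k)⁻¹ := by
  have key : (MulAut.conj (ofLeft G k)) u = (MulAut.conj (ofRight G k)) u := by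
    refine D_induction (q := fun u => (MulAut.conj (ofLeft G k)) u = (MulAut.conj (ofRight G k)) u)
      (fun a b => conj_commutator_left_eq_right commute_ofLeft_ofRight a b k) (by simp)
      (fun x _ y _ hx hy => by rw [map_mul, map_mul, hx, hy])
      (fun x _ hx => by rw [map_inv, map_inv, hx]) hu
  exact key

/-- Conjugation by k and by k^φ agree on `D G`, so every generator k⁻¹k^φ of `L G` centralises it.
-/
theorem commute_of_mem_D_of_mem_L {u l : Chi G} (hu : u ∈ D G) (hl : l ∈ L G) : Commute u l := by
  have : L G ≤ Subgroup.centralizer {u} := by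
    rw [L, Subgroup.closure_le]
    rintro _ ⟨k, rfl⟩
    rw [SetLike.mem_coe, Subgroup.mem_centralizer_singleton_iff]
    have h := conj_left_eq_conj_right_of_mem_D hu k
    calc (ofLeft G k)⁻¹ * ofRight G k * u
        = (ofLeft G k)⁻¹ * (ofRight G k * u * (ofRight G k)⁻¹) * ofRight G k := by group
      _ = _ := by rw [← h]; group
  exact (Subgroup.mem_centralizer_singleton_iff.1 (this hl)).symm

instance D_normal : (D G).Normal := by
  have hleft : ∀ k : G, ∀ u ∈ D G, ofLeft G k * u * (ofLeft G k)⁻¹ ∈ D G := by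
    intro k u hu
    change MulAut.conj (ofLeft G k) u ∈ D G
    refine D_induction (q := fun u => MulAut.conj (ofLeft G k) u ∈ D G) ?_ (by simp [one_mem])
      (fun x _ y _ hx hy => by rw [map_mul]; exact mul_mem hx hy)
      (fun x _ hx => by rw [map_inv]; exact inv_mem hx) hu
    intro a b
    rw [MulAut.conj_apply, conj_left_commutator]
    exact mul_mem (commutator_mem_D _ _) (inv_mem (commutator_mem_D _ _))
  refine ⟨fun u hu x => ?_⟩
  refine chi_induction (q := fun x => ∀ u ∈ D G, x * u * x⁻¹ ∈ D G) hleft ?_ ?_ x u hu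
  · intro k u hu
    rw [← conj_left_eq_conj_right_of_mem_D hu]
    exact hleft k u hu
  · intro x y hx hy u hu
    have := hx _ (hy u hu)
    rwa [show x * y * u * (x * y)⁻¹ = x * (y * u * y⁻¹) * x⁻¹ by group]

theorem inv_left_mul_right_mem_L (g : G) : (ofLeft G g)⁻¹ * ofRight G g ∈ L G :=
  Subgroup.subset_closure ⟨g, rfl⟩

theorem right_mul_inv_left_mem_L (g : G) : ofRight G g * (ofLeft G g)⁻¹ ∈ L G := by
  rw [← (commute_ofLeft_ofRight g).inv_left.eq]
  exact inv_left_mul_right_mem_L g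

instance L_normal : (L G).Normal := by
  have hleft : ∀ k : G, ∀ u ∈ L G, ofLeft G k * u * (ofLeft G k)⁻¹ ∈ L G := by
    intro k u hu
    suffices h : L G ≤ (L G).comap (MulAut.conj (ofLeft G k)).toMonoidHom from h hu
    conv_lhs => rw [L]
    rw [Subgroup.closure_le]
    rintro _ ⟨g, rfl⟩
    change ofLeft G k * ((ofLeft G g)⁻¹ * ofRight G g) * (ofLeft G k)⁻¹ ∈ L G
    rw [(commute_ofLeft_ofRight g).inv_left.eq]
    have := mul_mem (inv_mem (right_mul_inv_left_mem_L k)) (right_mul_inv_left_mem_L (k * g))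
    rw [map_mul, map_mul] at this
    convert this using 1
    group
  refine ⟨fun u hu x => ?_⟩
  refine chi_induction (q := fun x => ∀ u ∈ L G, x * u * x⁻¹ ∈ L G) hleft ?_ ?_ x u hu
  · intro k u hu
    have h1 := hleft k _ (mul_mem (mul_mem (inv_left_mul_right_mem_L k) hu)
      (inv_mem (inv_left_mul_right_mem_L k)))
    convert h1 using 1
    group
  · intro x y hx hy u hu
    have := hx _ (hy u hu)
    rwa [show x * y * u * (x * y)⁻¹ = x * (y * u * y⁻¹) * x⁻¹ by group]

/-- Modulo `L G` the two copies of G coincide, so the quotient map factors through `fold G`. -/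
theorem mem_L_of_fold_eq_one {x : Chi G} (hx : fold G x = 1) : x ∈ L G := by
  have h := chi_hom_ext (f := QuotientGroup.mk' (L G))
    (f' := (QuotientGroup.mk' (L G)).comp ((ofLeft G).comp (fold G))) (by simp)
    (fun g => by
      simp only [MonoidHom.comp_apply, fold_ofRight]
      exact (QuotientGroup.eq.2 (inv_left_mul_right_mem_L g)).symm) x
  simp only [MonoidHom.comp_apply, hx, map_one] at h
  exact (QuotientGroup.eq_one_iff x).1 h

theorem fold_eq_one_of_mem_L {x : Chi G} (hx : x ∈ L G) : fold G x = 1 := by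
  have : L G ≤ (fold G).ker := by
    rw [L, Subgroup.closure_le]
    rintro _ ⟨g, rfl⟩
    simp
  exact this hx

/-- Modulo `D G` the two copies commute, so the quotient map factors through G × G. -/
theorem mem_D_of_proj_eq_one {x : Chi G} (h1 : projLeft G x = 1) (h2 : projRight G x = 1) :
    x ∈ D G := by
  have hc : ∀ a b : G, Commute (((QuotientGroup.mk' (D G)).comp (ofLeft G)) a)
      (((QuotientGroup.mk' (D G)).comp (ofRight G)) b) := by
    intro a b
    rw [← commutatorElement_eq_one_iff_commute, MonoidHom.comp_apply, MonoidHom.comp_apply,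
      ← map_commutatorElement]
    exact (QuotientGroup.eq_one_iff _).2 (commutator_mem_D a b)
  have h := chi_hom_ext (f := QuotientGroup.mk' (D G))
    (f' := (MonoidHom.noncommCoprod _ _ hc).comp ((projLeft G).prod (projRight G)))
    (by simp) (by simp) x
  simp only [MonoidHom.comp_apply, MonoidHom.prod_apply, h1, h2] at h
  exact (QuotientGroup.eq_one_iff x).1 (h.trans (map_one _))

theorem proj_eq_one_of_mem_D {x : Chi G} (hx : x ∈ D G) :
    projLeft G x = 1 ∧ projRight G x = 1 :=
  D_induction (q := fun x => projLeft G x = 1 ∧ projRight G x = 1) (by simp [map_commutatorElement])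
    (by simp) (fun x _ y _ hx hy => by simp [hx, hy]) (fun x _ hx => by simp [hx]) hx

theorem fold_mem_commutator_of_mem_D {x : Chi G} (hx : x ∈ D G) : fold G x ∈ commutator G := by
  refine D_induction (q := fun x => fold G x ∈ commutator G) ?_ (by simp [one_mem])
    (fun x _ y _ hx hy => by rw [map_mul]; exact mul_mem hx hy)
    (fun x _ hx => by rw [map_inv]; exact inv_mem hx) hx
  intro a b
  rw [map_commutatorElement]
  exact Subgroup.commutator_mem_commutator (Subgroup.mem_top _) (Subgroup.mem_top _)

theorem mem_P {x : Chi G} : x ∈ P G ↔ fold G x = 1 ∧ projRight G x = 1 := by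
  simp [P, Subgroup.mem_inf, MonoidHom.mem_ker]

theorem mem_W {x : Chi G} : x ∈ W G ↔ x ∈ P G ∧ projLeft G x = 1 := by
  simp [W, Subgroup.mem_inf, MonoidHom.mem_ker]

theorem mem_L_of_mem_P {x : Chi G} (hx : x ∈ P G) : x ∈ L G := mem_L_of_fold_eq_one (mem_P.1 hx).1

theorem mem_D_of_mem_W {x : Chi G} (hx : x ∈ W G) : x ∈ D G :=
  mem_D_of_proj_eq_one (mem_W.1 hx).2 (mem_P.1 (mem_W.1 hx).1).2

theorem commute_of_mem_W_of_mem_L {w l : Chi G} (hw : w ∈ W G) (hl : l ∈ L G) : Commute w l :=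
  commute_of_mem_D_of_mem_L (mem_D_of_mem_W hw) hl

theorem commute_of_mem_W_of_mem_W {w v : Chi G} (hw : w ∈ W G) (hv : v ∈ W G) : Commute w v :=
  commute_of_mem_W_of_mem_L hw (mem_L_of_mem_P (mem_W.1 hv).1)

theorem commutator_left_L_le_P : ⁅(ofLeft G).range, L G⁆ ≤ P G := by
  rw [Subgroup.commutator_le]
  rintro _ ⟨g, rfl⟩ l hl
  rw [mem_P]
  simp [map_commutatorElement, fold_eq_one_of_mem_L hl]

theorem commutator_right_mem_W {x : Chi G} (hx : x ∈ P G) (k : G) : ⁅x, ofRight G k⁆ ∈ W G := by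
  rw [mem_W, mem_P]
  simp [map_commutatorElement, (mem_P.1 hx).1, (mem_P.1 hx).2]

theorem ofLeft_fold_inv_mul_mem_P {u : Chi G} (hu : u ∈ D G) : (ofLeft G (fold G u))⁻¹ * u ∈ P G := by
  simp [mem_P, (proj_eq_one_of_mem_D hu).2]

theorem exists_mem_D_of_mem_P {x : Chi G} (hx : x ∈ P G) :
    ∃ u ∈ D G, x = (ofLeft G (fold G u))⁻¹ * u := by
  refine ⟨ofLeft G (projLeft G x)⁻¹ * x, mem_D_of_proj_eq_one (by simp) (by simp [(mem_P.1 hx).2]), ?_⟩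
  simp [(mem_P.1 hx).1]

theorem projLeft_mem_commutator_of_mem_P {x : Chi G} (hx : x ∈ P G) :
    projLeft G x ∈ commutator G := by
  obtain ⟨u, hu, rfl⟩ := exists_mem_D_of_mem_P hx
  simpa [(proj_eq_one_of_mem_D hu).1] using fold_mem_commutator_of_mem_D hu

theorem pow_mem_W_of_mem_P {x : Chi G} (hx : x ∈ P G) :
    x ^ Monoid.exponent (commutator G) ∈ W G := by
  rw [mem_W]
  refine ⟨pow_mem hx _, ?_⟩
  rw [map_pow]
  have := Monoid.pow_exponent_eq_one (⟨projLeft G x, projLeft_mem_commutator_of_mem_P hx⟩ : commutator G)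
  exact congrArg Subtype.val this

end Chi

/-! ### The bound exp(G') · exp(G). -/

section ExponentProduct

variable {G : Type*} [Group G]

/-- The left copy of `⁅a, b⁆` is a product of an element of `D G` and one of `P G ≤ L G`; w lies in
both `L G` and `D G`, hence commutes with each factor. -/
theorem commute_ofLeft_of_mem_W {w : Chi G} (hw : w ∈ W G) {c : G} (hc : c ∈ commutator G) :
    Commute w (ofLeft G c) := by
  have : commutator G ≤ (Subgroup.centralizer {w}).comap (ofLeft G) := by
    rw [commutator_def, Subgroup.commutator_le]
    intro a _ b _
    rw [Subgroup.mem_comap, Subgroup.mem_centralizer_singleton_iff]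
    have hP := ofLeft_fold_inv_mul_mem_P (commutator_mem_D a b)
    have hD := commute_of_mem_D_of_mem_L (commutator_mem_D a b) (mem_L_of_mem_P (mem_W.1 hw).1)
    rw [map_commutatorElement, fold_ofLeft, fold_ofRight] at hP
    have h := hD.symm.mul_right (commute_of_mem_W_of_mem_L hw (mem_L_of_mem_P hP)).inv_right
    simp only [mul_inv_rev, inv_inv, mul_inv_cancel_left] at h
    exact h.symm.eq
  exact (Subgroup.mem_centralizer_singleton_iff.1 (this hc)).symm

theorem commute_ofRight_of_mem_W {w : Chi G} (hw : w ∈ W G) {c : G} (hc : c ∈ commutator G) :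
    Commute w (ofRight G c) := by
  have h := (commute_ofLeft_of_mem_W hw hc).mul_right
    (commute_of_mem_W_of_mem_L hw (inv_left_mul_right_mem_L c))
  rwa [mul_inv_cancel_left] at h

theorem commutator_mul_right_eq {x y : Chi G} (hx : x ∈ P G) (hy : y ∈ P G) (k : G) :
    ⁅x * y, ofRight G k⁆ = ⁅x, ofRight G k⁆ * ⁅y, ofRight G k⁆ := by
  have h := (commute_of_mem_W_of_mem_L (commutator_right_mem_W hy k) (mem_L_of_mem_P hx)).eq
  have h' := (commute_of_mem_W_of_mem_W (commutator_right_mem_W hx k)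
    (commutator_right_mem_W hy k)).eq
  calc ⁅x * y, ofRight G k⁆ = x * ⁅y, ofRight G k⁆ * x⁻¹ * ⁅x, ofRight G k⁆ := by
        simp only [commutatorElement_def]; group
    _ = _ := by rw [← h, mul_inv_cancel_right, h']

theorem commutator_pow_right_eq {x : Chi G} (hx : x ∈ P G) (k : G) (n : ℕ) :
    ⁅x ^ n, ofRight G k⁆ = ⁅x, ofRight G k⁆ ^ n := by
  induction n with
  | zero => simp
  | succ n ih => rw [pow_succ, pow_succ, commutator_mul_right_eq (pow_mem hx n) hx, ih]

theorem commutator_inv_right_eq {x : Chi G} (hx : x ∈ P G) (k : G) :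
    ⁅x⁻¹, ofRight G k⁆ = ⁅x, ofRight G k⁆⁻¹ := by
  rw [eq_inv_iff_mul_eq_one, ← commutator_mul_right_eq (inv_mem hx) hx]
  simp

theorem commutator_right_mul (x : Chi G) (k k' : G) : ⁅x, ofRight G (k * k')⁆ =
    ⁅x, ofRight G k⁆ * (ofRight G k * ⁅x, ofRight G k'⁆ * (ofRight G k)⁻¹) := by
  rw [map_mul]; simp only [commutatorElement_def]; group

theorem commutator_right_pow_exponent_eq_one {x : Chi G} (hx : x ∈ P G) {c : G}
    (hc : c ∈ commutator G) : ⁅x, ofRight G c⁆ ^ Monoid.exponent (commutator G) = 1 := by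
  have h : ∀ n : ℕ, ⁅x, ofRight G (c ^ n)⁆ = ⁅x, ofRight G c⁆ ^ n := by
    intro n
    induction n with
    | zero => simp
    | succ n ih =>
      rw [pow_succ', commutator_right_mul, ih, pow_succ',
        ← (commute_ofRight_of_mem_W (pow_mem (commutator_right_mem_W hx c) n) hc).eq,
        mul_inv_cancel_right]
  have := Monoid.pow_exponent_eq_one (⟨c, hc⟩ : commutator G)
  rw [← h, show c ^ Monoid.exponent (commutator G) = 1 from congrArg Subtype.val this]
  simp

/-- The element of `P(G)` congruent to `[a, b]⁻¹` modulo `D(G)`. -/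
def commDefect (a b : G) : Chi G := (ofLeft G ⁅a, b⁆)⁻¹ * ⁅ofLeft G a, ofRight G b⁆

theorem commDefect_mem_P (a b : G) : commDefect a b ∈ P G := by
  have h := ofLeft_fold_inv_mul_mem_P (commutator_mem_D a b)
  rwa [map_commutatorElement, fold_ofLeft, fold_ofRight] at h

theorem commDefect_swap (a b : G) : commDefect b a = (commDefect a b)⁻¹ := by
  have h := (commute_of_mem_D_of_mem_L (commutator_mem_D a b)
    (mem_L_of_mem_P (commDefect_mem_P a b))).eq
  have h2 : ofLeft G ⁅a, b⁆ = ⁅ofLeft G a, ofRight G b⁆ * (commDefect a b)⁻¹ := by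
    simp only [commDefect]; group
  have h3 : commDefect b a = ofLeft G ⁅a, b⁆ * ⁅ofLeft G a, ofRight G b⁆⁻¹ := by
    rw [commDefect, ← commutatorElement_inv a b, map_inv, inv_inv,
      commutator_right_left_inv commute_ofLeft_ofRight]
  rw [h3, h2, mul_inv_eq_iff_eq_mul, eq_inv_mul_iff_mul_eq, ← mul_assoc, ← h, mul_inv_cancel_right]

theorem commDefect_self (a : G) : commDefect a a = 1 := by
  have := (commutatorElement_eq_one_iff_commute).2 (commute_ofLeft_ofRight a)
  simp [commDefect, this]

/-- Conjugate by h^φ instead of h: the right entry transforms as expected, while the left one picks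
up the defect of (h, a), which contributes a factor in `W G`. -/
theorem conj_commutator_eq (a b h : G) :
    ofLeft G h * ⁅ofLeft G a, ofRight G b⁆ * (ofLeft G h)⁻¹ =
      ⁅ofLeft G (h * a * h⁻¹), ofRight G (h * b * h⁻¹)⁆ *
        ⁅commDefect h a, ofRight G (h * b * h⁻¹)⁆ := by
  set B := h * b * h⁻¹ with hB
  have hn := commDefect_mem_P h a
  have e1 : ofRight G h * ofLeft G a * (ofRight G h)⁻¹ =
      ofLeft G ⁅h, a⁆ * commDefect h a * ofLeft G a := by
    rw [commDefect, mul_inv_cancel_left, commutator_left_right_eq commute_ofLeft_ofRight]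
    simp only [commutatorElement_def]; group
  have e2 := (commute_of_mem_D_of_mem_L (commutator_mem_D a B) (mem_L_of_mem_P hn)).eq
  have hW := commutator_right_mem_W hn B
  have e4 := (commute_of_mem_D_of_mem_L (commutator_mem_D ⁅h, a⁆ B)
    (mem_L_of_mem_P (mem_W.1 hW).1)).eq
  have e5 : h * a * h⁻¹ = ⁅h, a⁆ * a := by simp [commutatorElement_def]
  rw [conj_left_eq_conj_right_of_mem_D (commutator_mem_D a b), e5]
  calc ofRight G h * ⁅ofLeft G a, ofRight G b⁆ * (ofRight G h)⁻¹
      = ⁅ofRight G h * ofLeft G a * (ofRight G h)⁻¹, ofRight G B⁆ := by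
        rw [hB, map_mul, map_mul, map_inv]; simp only [commutatorElement_def]; group
    _ = ofLeft G ⁅h, a⁆ * (commDefect h a * ⁅ofLeft G a, ofRight G B⁆ * (commDefect h a)⁻¹) *
          (⁅commDefect h a, ofRight G B⁆ * (ofLeft G ⁅h, a⁆)⁻¹) *
          ⁅ofLeft G ⁅h, a⁆, ofRight G B⁆ := by
        rw [e1]; simp only [commutatorElement_def]; group
    _ = ofLeft G ⁅h, a⁆ * ⁅ofLeft G a, ofRight G B⁆ * (ofLeft G ⁅h, a⁆)⁻¹ *
          (⁅ofLeft G ⁅h, a⁆, ofRight G B⁆ * ⁅commDefect h a, ofRight G B⁆) := by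
        rw [← e2, mul_inv_cancel_right, e4]
        have e6 := (commute_ofLeft_of_mem_W hW
          (Subgroup.commutator_mem_commutator (Subgroup.mem_top h) (Subgroup.mem_top a))).inv_right.eq
        rw [e6]; group
    _ = _ := by
        generalize ⁅h, a⁆ = c
        rw [map_mul (ofLeft G) c a]; simp only [commutatorElement_def]; group

/-- Exchanging a and b inverts `[a, b^φ]`, so the two correction factors of `conj_commutator_eq`
must be mutually inverse. -/
theorem commutator_commDefect_mul_eq_one (a b h : G) :
    ⁅commDefect h a, ofRight G (h * b * h⁻¹)⁆ * ⁅commDefect h b, ofRight G (h * a * h⁻¹)⁆ = 1 := by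
  have h1 := conj_commutator_eq a b h
  have h2 := conj_commutator_eq b a h
  rw [commutator_right_left_inv commute_ofLeft_ofRight a b,
    commutator_right_left_inv commute_ofLeft_ofRight (h * a * h⁻¹) (h * b * h⁻¹),
    ← conj_inv, h1] at h2
  have hW := commutator_right_mem_W (commDefect_mem_P h a) (h * b * h⁻¹)
  rw [mul_inv_rev, (commute_of_mem_D_of_mem_L (commutator_mem_D (h * a * h⁻¹) (h * b * h⁻¹))
    (mem_L_of_mem_P (mem_W.1 hW).1)).inv_inv.eq.symm] at h2
  rw [← mul_left_cancel h2, mul_inv_cancel]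

/-- Up to elements killed by `exp(G')`, conjugating the right entry does not matter. -/
theorem commutator_conj_right_pow {x : Chi G} (hx : x ∈ P G) (k h : G) :
    ⁅x, ofRight G (h * k * h⁻¹)⁆ ^ Monoid.exponent (commutator G) =
      ⁅x, ofRight G k⁆ ^ Monoid.exponent (commutator G) := by
  have hc : ⁅h, k⁆ ∈ commutator G :=
    Subgroup.commutator_mem_commutator (Subgroup.mem_top h) (Subgroup.mem_top k)
  rw [show h * k * h⁻¹ = ⁅h, k⁆ * k by simp [commutatorElement_def], commutator_right_mul,
    ← (commute_ofRight_of_mem_W (commutator_right_mem_W hx k) hc).eq, mul_inv_cancel_right,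
    (commute_of_mem_W_of_mem_W (commutator_right_mem_W hx _) (commutator_right_mem_W hx _)).mul_pow,
    commutator_right_pow_exponent_eq_one hx hc, one_mul]

theorem commutator_commDefect_pow_swap (a b h : G) :
    ⁅commDefect h a, ofRight G b⁆ ^ Monoid.exponent (commutator G) =
      (⁅commDefect h b, ofRight G a⁆ ^ Monoid.exponent (commutator G))⁻¹ := by
  have h1 := commutator_commDefect_mul_eq_one a b h
  have h2 := congrArg (· ^ Monoid.exponent (commutator G)) h1
  simp only [one_pow] at h2
  rw [(commute_of_mem_W_of_mem_W (commutator_right_mem_W (commDefect_mem_P h a) _)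
    (commutator_right_mem_W (commDefect_mem_P h b) _)).mul_pow,
    commutator_conj_right_pow (commDefect_mem_P h a),
    commutator_conj_right_pow (commDefect_mem_P h b)] at h2
  exact eq_inv_of_mul_eq_one_left h2

theorem commutator_commDefect_pow_antisymm (a b h : G) :
    ⁅commDefect a b, ofRight G h⁆ ^ Monoid.exponent (commutator G) =
      (⁅commDefect b a, ofRight G h⁆ ^ Monoid.exponent (commutator G))⁻¹ := by
  rw [commDefect_swap a b, commutator_inv_right_eq (commDefect_mem_P a b), inv_pow, inv_inv]

/-- A product of two transpositions; the e-th power changes sign under each. -/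
theorem commutator_commDefect_pow_rotate (a b h : G) :
    ⁅commDefect a b, ofRight G h⁆ ^ Monoid.exponent (commutator G) =
      ⁅commDefect h a, ofRight G b⁆ ^ Monoid.exponent (commutator G) := by
  rw [commutator_commDefect_pow_swap b h a, commutator_commDefect_pow_antisymm a h b, inv_inv]

theorem commutator_commDefect_pow_eq_one (a h : G) :
    ⁅commDefect h a, ofRight G h⁆ ^ Monoid.exponent (commutator G) = 1 := by
  rw [commutator_commDefect_pow_swap a h h, commDefect_self]
  simp

/-- Since hk and kh are conjugate, `[x, (hk)^φ]` and `[x, (kh)^φ]` have equal e-th powers; expanding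
both leaves exactly the two double commutators. -/
theorem commutator_commutator_pow_comm {x : Chi G} (hx : x ∈ P G) (h k : G) :
    ⁅⁅x, ofRight G h⁆ ^ Monoid.exponent (commutator G), ofRight G k⁆ =
      ⁅⁅x, ofRight G k⁆ ^ Monoid.exponent (commutator G), ofRight G h⁆ := by
  have hh := commutator_right_mem_W hx h
  have hk := commutator_right_mem_W hx k
  rw [commutator_pow_right_eq (mem_W.1 hh).1, commutator_pow_right_eq (mem_W.1 hk).1]
  have key : ∀ a b : G, ⁅x, ofRight G (a * b)⁆ =
      ⁅x, ofRight G a⁆ * ⁅x, ofRight G b⁆ * ⁅⁅x, ofRight G b⁆, ofRight G a⁆⁻¹ := by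
    intro a b
    have h1 := commutator_right_mem_W hx b
    have h2 := commutator_right_mem_W (mem_W.1 h1).1 a
    rw [commutator_right_mul, mul_assoc ⁅x, ofRight G a⁆ ⁅x, ofRight G b⁆, mul_right_inj,
      ← (commute_of_mem_W_of_mem_W h2 h1).inv_left.eq]
    simp only [commutatorElement_def]; group
  have hconj := commutator_conj_right_pow hx (h * k) k
  rw [show k * (h * k) * k⁻¹ = k * h by group, key k h, key h k,
    (commute_of_mem_W_of_mem_W (mul_mem hk hh)
      (inv_mem (commutator_right_mem_W (mem_W.1 hh).1 k))).mul_pow,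
    (commute_of_mem_W_of_mem_W (mul_mem hh hk)
      (inv_mem (commutator_right_mem_W (mem_W.1 hk).1 h))).mul_pow,
    (commute_of_mem_W_of_mem_W hk hh).eq, mul_right_inj, inv_pow, inv_pow, inv_inj] at hconj
  exact hconj

/-- For a defect, rotate h into its first slot and swap the two outer entries: h then occurs twice
in an alternating expression. The general case follows by multiplicativity in x. -/
theorem commutator_commutator_pow_eq_one {x : Chi G} (hx : x ∈ P G) (h : G) :
    ⁅⁅x, ofRight G h⁆ ^ Monoid.exponent (commutator G), ofRight G h⁆ = 1 := by
  have step : ∀ y ∈ P G, ∀ z ∈ P G,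
      ⁅⁅y * z, ofRight G h⁆ ^ Monoid.exponent (commutator G), ofRight G h⁆ =
        ⁅⁅y, ofRight G h⁆ ^ Monoid.exponent (commutator G), ofRight G h⁆ *
          ⁅⁅z, ofRight G h⁆ ^ Monoid.exponent (commutator G), ofRight G h⁆ := by
    intro y hy z hz
    have hy' := commutator_right_mem_W hy h
    have hz' := commutator_right_mem_W hz h
    rw [commutator_mul_right_eq hy hz, (commute_of_mem_W_of_mem_W hy' hz').mul_pow,
      commutator_mul_right_eq (pow_mem (mem_W.1 hy').1 _) (pow_mem (mem_W.1 hz').1 _)]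
  obtain ⟨u, hu, rfl⟩ := exists_mem_D_of_mem_P hx
  -- The parametrisation of `P G` by `D G` is an anti-homomorphism, so induction over the generators
  -- of `D G` covers all of `P G`.
  have hmul : ∀ u ∈ D G, ∀ v ∈ D G, (ofLeft G (fold G (u * v)))⁻¹ * (u * v) =
      ((ofLeft G (fold G v))⁻¹ * v) * ((ofLeft G (fold G u))⁻¹ * u) := by
    intro u hu v hv
    have := (commute_of_mem_D_of_mem_L hv (mem_L_of_mem_P (ofLeft_fold_inv_mul_mem_P hu))).eq
    rw [mul_assoc _ v, this, map_mul, map_mul]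
    group
  refine D_induction (q := fun u => ⁅⁅(ofLeft G (fold G u))⁻¹ * u, ofRight G h⁆ ^
    Monoid.exponent (commutator G), ofRight G h⁆ = 1) ?_ (by simp) ?_ ?_ hu
  · intro a b
    have : (ofLeft G (fold G ⁅ofLeft G a, ofRight G b⁆))⁻¹ * ⁅ofLeft G a, ofRight G b⁆ =
        commDefect a b := by
      rw [map_commutatorElement, fold_ofLeft, fold_ofRight, commDefect]
    rw [this, commutator_commDefect_pow_rotate, commutator_commutator_pow_comm (commDefect_mem_P _ _),
      commutator_commDefect_pow_eq_one]
    simp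
  · intro u hu v hv h1 h2
    rw [hmul u hu v hv, step _ (ofLeft_fold_inv_mul_mem_P hv) _ (ofLeft_fold_inv_mul_mem_P hu),
      h1, h2, one_mul]
  · intro u hu h1
    have h2 := step _ (ofLeft_fold_inv_mul_mem_P hu) _ (ofLeft_fold_inv_mul_mem_P (inv_mem hu))
    rw [← hmul _ (inv_mem hu) _ hu, h1, one_mul] at h2
    rw [← h2]
    simp

theorem commutator_right_pow_mul_eq_one {x : Chi G} (hx : x ∈ P G) (h : G) :
    ⁅x, ofRight G h⁆ ^ (Monoid.exponent (commutator G) * Monoid.exponent G) = 1 := by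
  have hfix := (commutatorElement_eq_one_iff_commute).1 (commutator_commutator_pow_eq_one hx h)
  have key : ∀ m : ℕ, ⁅x, ofRight G (h ^ m)⁆ ^ Monoid.exponent (commutator G) =
      (⁅x, ofRight G h⁆ ^ Monoid.exponent (commutator G)) ^ m := by
    intro m
    induction m with
    | zero => simp
    | succ m ih =>
      have hW := commutator_right_mem_W hx (h ^ m)
      have hW' : ofRight G h * ⁅x, ofRight G (h ^ m)⁆ * (ofRight G h)⁻¹ ∈ W G :=
        Subgroup.Normal.conj_mem inferInstance _ hW _
      rw [pow_succ', commutator_right_mul,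
        (commute_of_mem_W_of_mem_W (commutator_right_mem_W hx h) hW').mul_pow, conj_pow, ih,
        ← (hfix.pow_left m).eq, mul_inv_cancel_right, ← pow_succ']
  rw [pow_mul, ← key, Monoid.pow_exponent_eq_one]
  simp

theorem pow_eq_one_of_mem_R {m : ℕ}
    (hm : ∀ x ∈ ⁅(ofLeft G).range, L G⁆, ∀ h : G, ⁅x, ofRight G h⁆ ^ m = 1) {r : Chi G}
    (hr : r ∈ R G) : r ^ m = 1 := by
  suffices r ∈ W G ∧ r ^ m = 1 from this.2
  rw [R, Subgroup.commutator_def] at hr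
  induction hr using Subgroup.closure_induction with
  | mem y hy =>
    obtain ⟨x, hx, _, ⟨k, rfl⟩, rfl⟩ := hy
    exact ⟨commutator_right_mem_W (commutator_left_L_le_P hx) k, hm x hx k⟩
  | one => exact ⟨one_mem _, one_pow m⟩
  | mul x y _ _ hx hy =>
    exact ⟨mul_mem hx.1 hy.1, by
      rw [(commute_of_mem_W_of_mem_W hx.1 hy.1).mul_pow, hx.2, hy.2, one_mul]⟩
  | inv x _ hx => exact ⟨inv_mem hx.1, by rw [inv_pow, hx.2, inv_one]⟩

variable (G)

theorem exponent_R_dvd_mul :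
    Monoid.exponent (R G) ∣ Monoid.exponent (commutator G) * Monoid.exponent G := by
  refine Monoid.exponent_dvd_of_forall_pow_eq_one fun r => Subtype.ext ?_
  exact pow_eq_one_of_mem_R
    (fun x hx h => commutator_right_pow_mul_eq_one (commutator_left_L_le_P hx) h) r.2

end ExponentProduct

/-! ### Biderivations vanishing on the diagonal. -/

section Biderivation

variable {G A : Type*} [Group G] [AddCommGroup A] {ρ : G → A ≃+ A} {f : G → G → A}

/-- Expand `f (g * h) (g * h) = 0`. -/
theorem biderivation_swap (hl : ∀ g h k, f (g * h) k = ρ g (f h k) + f g k)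
    (hr : ∀ g k k', f g (k * k') = f g k + f g k' + ρ g (f k k') - f k k')
    (hs : ∀ g, f g g = 0) (g h : G) : f h g = -ρ h (f g h) := by
  have h1 := hs (g * h)
  rw [hl, hr, hr, hs, hs] at h1
  have h2 : ρ g (f h g + ρ h (f g h)) = 0 := by
    simp only [map_add, map_sub, map_zero] at h1 ⊢
    rw [← h1]; abel
  rw [map_eq_zero_iff _ (ρ g).injective] at h2
  exact eq_neg_of_add_eq_zero_left h2

theorem biderivation_fixed (hl : ∀ g h k, f (g * h) k = ρ g (f h k) + f g k)
    (hr : ∀ g k k', f g (k * k') = f g k + f g k' + ρ g (f k k') - f k k')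
    (hs : ∀ g, f g g = 0) (g h : G) : ρ g (f h g) = f h g := by
  -- Here `f (h * g) g` collapses to `f h g`, because `f g g = 0`.
  have h1 := biderivation_swap hl hr hs (h * g) g
  rw [hl, hs, map_zero, zero_add, hr, hs, biderivation_swap hl hr hs h g] at h1
  have h2 : ρ g (f h g) - f h g = 0 := by
    have h3 : -ρ g (f h g) + 0 + ρ g (f h g) - f h g = -ρ g (f h g) := h1
    have h4 := sub_eq_zero.2 h3
    rw [← h4]; abel
  exact sub_eq_zero.1 h2

theorem biderivation_antisymm (hl : ∀ g h k, f (g * h) k = ρ g (f h k) + f g k)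
    (hr : ∀ g k k', f g (k * k') = f g k + f g k' + ρ g (f k k') - f k k')
    (hs : ∀ g, f g g = 0) (g h : G) : f g h = -f h g := by
  rw [biderivation_swap hl hr hs h g, biderivation_fixed hl hr hs]

/-- Antisymmetry at `(g * h, k)` shows that the quantity `ρ g (f h k) - f h k` changes sign under a
cyclic rotation of (g, h, k). Three rotations give the identity, so it equals its own negative. -/
theorem two_nsmul_biderivation_sub (hl : ∀ g h k, f (g * h) k = ρ g (f h k) + f g k)
    (hr : ∀ g k k', f g (k * k') = f g k + f g k' + ρ g (f k k') - f k k')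
    (hs : ∀ g, f g g = 0) (g h k : G) : 2 • (ρ g (f h k) - f h k) = 0 := by
  have anti := biderivation_antisymm hl hr hs
  have cyc : ∀ g h k, (ρ g (f h k) - f h k) + (ρ k (f g h) - f g h) = 0 := by
    intro g h k
    have h1 := anti (g * h) k
    rw [hl, hr, anti k g, anti k h] at h1
    rw [← sub_eq_zero] at h1
    rw [← h1]; abel
  have h1 := cyc g h k
  have h2 := cyc k g h
  have h3 := cyc h k g
  calc 2 • (ρ g (f h k) - f h k)
      = ((ρ g (f h k) - f h k) + (ρ k (f g h) - f g h)) -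
          ((ρ k (f g h) - f g h) + (ρ h (f k g) - f k g)) +
          ((ρ h (f k g) - f k g) + (ρ g (f h k) - f h k)) := by abel
    _ = 0 := by rw [h1, h2, h3]; simp

theorem biderivation_pow (hl : ∀ g h k, f (g * h) k = ρ g (f h k) + f g k)
    (hr : ∀ g k k', f g (k * k') = f g k + f g k' + ρ g (f k k') - f k k')
    (hs : ∀ g, f g g = 0) (g k : G) (n : ℕ) : f (g ^ n) k = n • f g k := by
  induction n with
  | zero =>
    have := hl 1 1 k
    rw [mul_one] at this
    have h0 : ρ 1 (f 1 k) = 0 := by simpa using this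
    simpa using h0
  | succ n ih =>
    have hfix : ρ g (f g k) = f g k := by
      rw [biderivation_antisymm hl hr hs g k, map_neg, biderivation_fixed hl hr hs]
    rw [pow_succ', hl, ih, map_nsmul, hfix, succ_nsmul]

end Biderivation

/-! ### The biderivation (g, k) ↦ [g, k^φ k⁻¹] in an abstract quotient. -/

section CentralPair

variable {G Q : Type*} [Group G] [Group Q] {i j : G →* Q} {N : Subgroup Q}

theorem commutator_sq_and_pow_of_central [hn : N.Normal] (hij : ∀ g, Commute (i g) (j g))
    (hL : ∀ g k, ⁅i g, j k * (i k)⁻¹⁆ ∈ N) (hc : ∀ x ∈ N, ∀ k, Commute x (j k * (i k)⁻¹))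
    (hN : ∀ x ∈ N, ∀ y ∈ N, Commute x y) (g h k : G) :
    ⁅i g, ⁅i h, j k * (i k)⁻¹⁆⁆ ^ 2 = 1 ∧
      ∀ n : ℕ, ⁅i (h ^ n), j k * (i k)⁻¹⁆ = ⁅i h, j k * (i k)⁻¹⁆ ^ n := by
  let _ : CommGroup N :=
    { (inferInstance : Group N) with
      mul_comm := fun x y => Subtype.ext (hN x x.2 y y.2).eq }
  let ρ : G → Additive N ≃+ Additive N := fun g =>
    MulEquiv.toAdditive (MulAut.conjNormal (H := N) (i g))
  let f : G → G → Additive N := fun g k => Additive.ofMul ⟨⁅i g, j k * (i k)⁻¹⁆, hL g k⟩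
  have hl : ∀ g h k, f (g * h) k = ρ g (f h k) + f g k := by
    intro g h k
    refine congrArg Additive.ofMul (Subtype.ext ?_)
    change ⁅i (g * h), j k * (i k)⁻¹⁆ = i g * ⁅i h, j k * (i k)⁻¹⁆ * (i g)⁻¹ * ⁅i g, j k * (i k)⁻¹⁆
    rw [map_mul]; simp only [commutatorElement_def]; group
  have hr : ∀ g k k', f g (k * k') = f g k + f g k' + ρ g (f k k') - f k k' := by
    intro g k k'
    have h1 : j (k * k') * (i (k * k'))⁻¹ =
        ⁅i k, j k' * (i k')⁻¹⁆ * ((j k * (i k)⁻¹) * (j k' * (i k')⁻¹)) := by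
      have e1 : j (k * k') * (i (k * k'))⁻¹ =
          (j k * (i k)⁻¹) * ⁅i k, j k' * (i k')⁻¹⁆ * (j k' * (i k')⁻¹) := by
        rw [map_mul, map_mul]; simp only [commutatorElement_def]; group
      rw [e1, ← (hc _ (hL k k') k).eq]
      group
    rw [sub_eq_add_neg]
    refine congrArg Additive.ofMul (Subtype.ext ?_)
    change ⁅i g, j (k * k') * (i (k * k'))⁻¹⁆ =
      ⁅i g, j k * (i k)⁻¹⁆ * ⁅i g, j k' * (i k')⁻¹⁆ *
        (i g * ⁅i k, j k' * (i k')⁻¹⁆ * (i g)⁻¹) * ⁅i k, j k' * (i k')⁻¹⁆⁻¹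
    have hgk := hL g k
    have hgk' := hL g k'
    have hkk' := hL k k'
    have hc2 := hc _ hgk' k
    have hz := hn.conj_mem _ hkk' (i g)
    rw [h1]
    generalize j k * (i k)⁻¹ = l at *
    generalize j k' * (i k')⁻¹ = l' at *
    generalize ⁅i k, l'⁆ = z at *
    have e2 : ⁅i g, z * (l * l')⁆ =
        (i g * z * (i g)⁻¹) * (⁅i g, l⁆ * (l * ⁅i g, l'⁆ * l⁻¹)) * z⁻¹ := by
      simp only [commutatorElement_def]; group
    rw [e2, ← hc2.eq, mul_inv_cancel_right, (hN _ hz _ (mul_mem hgk hgk')).eq]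
  have hs : ∀ g, f g g = 0 := by
    intro g
    refine congrArg Additive.ofMul (Subtype.ext ?_)
    change ⁅i g, j g * (i g)⁻¹⁆ = 1
    rw [commutatorElement_eq_one_iff_commute]
    exact (hij g).mul_right (Commute.refl _).inv_right
  constructor
  · have h2 := two_nsmul_biderivation_sub hl hr hs g h k
    rw [sub_eq_add_neg] at h2
    exact congrArg (fun x : Additive N => (x.toMul : Q)) h2
  · intro n
    exact congrArg (fun x : Additive N => (x.toMul : Q)) (biderivation_pow hl hr hs h k n)

theorem pow_eq_one_of_mem_commutator_of_central (hnorm : N.Normal)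
    (hL : ∀ g k, ⁅i g, j k * (i k)⁻¹⁆ ∈ N) (hc : ∀ x ∈ N, ∀ k, Commute x (j k * (i k)⁻¹))
    (hN : ∀ x ∈ N, ∀ y ∈ N, Commute x y) {m : ℕ}
    (hm : ∀ g h k, ⁅i g, ⁅i h, j k * (i k)⁻¹⁆⁆ ^ m = 1) {r : Q}
    (hr : r ∈ ⁅⁅i.range, Subgroup.closure (Set.range fun k => j k * (i k)⁻¹)⁆, j.range⁆) :
    r ^ m = 1 := by
  set M := Subgroup.closure (Set.range fun k => j k * (i k)⁻¹) with hM
  have hcM : ∀ x ∈ N, ∀ l ∈ M, Commute x l := by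
    intro x hx
    have : M ≤ Subgroup.centralizer {x} := by
      rw [hM, Subgroup.closure_le]
      rintro _ ⟨k, rfl⟩
      exact Subgroup.mem_centralizer_singleton_iff.2 (hc x hx k).eq.symm
    intro l hl
    exact (Subgroup.mem_centralizer_singleton_iff.1 (this hl)).symm
  have hmem : ∀ x ∈ N, ∀ y : Q, ⁅x, y⁆ ∈ N := by
    intro x hx y
    rw [show ⁅x, y⁆ = x * (y * x⁻¹ * y⁻¹) by simp only [commutatorElement_def]; group]
    exact mul_mem hx (hnorm.conj_mem _ (inv_mem hx) y)
  have hmul : ∀ x ∈ N, ∀ y ∈ N, ∀ z : Q, ⁅x * y, z⁆ = ⁅x, z⁆ * ⁅y, z⁆ := by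
    intro x hx y hy z
    rw [show ⁅x * y, z⁆ = x * ⁅y, z⁆ * x⁻¹ * ⁅x, z⁆ by simp only [commutatorElement_def]; group,
      (hN x hx _ (hmem y hy z)).eq, mul_inv_cancel_right, (hN _ (hmem y hy z) _ (hmem x hx z)).eq]
  let S : Subgroup Q :=
    { carrier := {x | x ∈ N ∧ ∀ h, ⁅x, j h⁆ ^ m = 1}
      one_mem' := ⟨one_mem _, by simp⟩
      mul_mem' := by
        rintro x y ⟨hx, hx'⟩ ⟨hy, hy'⟩
        refine ⟨mul_mem hx hy, fun h => ?_⟩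
        rw [hmul x hx y hy, (hN _ (hmem x hx _) _ (hmem y hy _)).mul_pow, hx', hy', one_mul]
      inv_mem' := by
        rintro x ⟨hx, hx'⟩
        refine ⟨inv_mem hx, fun h => ?_⟩
        have h1 := hmul x⁻¹ (inv_mem hx) x hx (j h)
        rw [inv_mul_cancel, commutatorElement_one_left] at h1
        rw [eq_inv_of_mul_eq_one_left h1.symm, inv_pow, hx', inv_one] }
  let V : Subgroup Q :=
    { carrier := {x | x ∈ N ∧ x ^ m = 1}
      one_mem' := ⟨one_mem _, by simp⟩
      mul_mem' := by
        rintro x y ⟨hx, hx'⟩ ⟨hy, hy'⟩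
        exact ⟨mul_mem hx hy, by rw [(hN x hx y hy).mul_pow, hx', hy', one_mul]⟩
      inv_mem' := by
        rintro x ⟨hx, hx'⟩
        exact ⟨inv_mem hx, by rw [inv_pow, hx', inv_one]⟩ }
  have hS : ⁅i.range, M⁆ ≤ S := by
    rw [Subgroup.commutator_le]
    rintro _ ⟨g, rfl⟩ l hl
    rw [hM] at hl
    induction hl using Subgroup.closure_induction with
    | mem y hy =>
      obtain ⟨k, rfl⟩ := hy
      refine ⟨hL g k, fun h => ?_⟩
      -- `j h` and `i h` act alike on `N`, since `j h * (i h)⁻¹` centralises it.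
      have h1 : ⁅⁅i g, j k * (i k)⁻¹⁆, j h⁆ = ⁅i h, ⁅i g, j k * (i k)⁻¹⁆⁆⁻¹ := by
        rw [commutatorElement_inv]
        have hx := hL g k
        generalize ⁅i g, j k * (i k)⁻¹⁆ = x at *
        rw [show ⁅x, j h⁆ = ⁅x, j h * (i h)⁻¹⁆ *
            ((j h * (i h)⁻¹) * ⁅x, i h⁆ * (j h * (i h)⁻¹)⁻¹) by
          simp only [commutatorElement_def]; group,
          (commutatorElement_eq_one_iff_commute).2 (hc x hx h), one_mul,
          ← (hc _ (hmem x hx (i h)) h).eq, mul_inv_cancel_right]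
      rw [h1, inv_pow, hm, inv_one]
    | one => simp [one_mem]
    | mul x y hx hy ihx ihy =>
      rw [show ⁅i g, x * y⁆ = ⁅i g, x⁆ * (x * ⁅i g, y⁆ * x⁻¹) by
        simp only [commutatorElement_def]; group, ← (hcM _ ihy.1 x hx).eq, mul_inv_cancel_right]
      exact mul_mem ihx ihy
    | inv x hx ihx =>
      rw [show ⁅i g, x⁻¹⁆ = x⁻¹ * ⁅i g, x⁆⁻¹ * x by
        simp only [commutatorElement_def]; group,
        mul_assoc, (hcM _ (inv_mem ihx.1) x hx).eq, inv_mul_cancel_left]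
      exact inv_mem ihx
  have hV : ⁅⁅i.range, M⁆, j.range⁆ ≤ V := by
    rw [Subgroup.commutator_le]
    rintro x hx _ ⟨h, rfl⟩
    exact ⟨hmem x (hS hx).1 _, (hS hx).2 h⟩
  exact (hV hr).2

end CentralPair

/-! ### Powers in groups of class two. -/

section ClassTwo

variable {X : Type*} [Group X]

theorem mul_pow_of_commutator_commute {a b : X} (ha : Commute ⁅b, a⁆ a) (hb : Commute ⁅b, a⁆ b)
    (n : ℕ) : (a * b) ^ n = ⁅b, a⁆ ^ n.choose 2 * a ^ n * b ^ n := by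
  have hba : b * a = ⁅b, a⁆ * a * b := by simp only [commutatorElement_def]; group
  generalize ⁅b, a⁆ = z at *
  have hpow : ∀ n : ℕ, b ^ n * a = z ^ n * a * b ^ n := by
    intro n
    induction n with
    | zero => simp
    | succ n ih =>
      calc b ^ (n + 1) * a = b ^ n * (b * a) := by rw [pow_succ, mul_assoc]
        _ = (b ^ n * z) * a * b := by rw [hba]; group
        _ = z * (b ^ n * a) * b := by rw [← (hb.pow_right n).eq]; group
        _ = z ^ (n + 1) * a * b ^ (n + 1) := by rw [ih, pow_succ', pow_succ]; group
  induction n with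
  | zero => simp
  | succ n ih =>
    calc (a * b) ^ (n + 1) = z ^ n.choose 2 * a ^ n * (b ^ n * a) * b := by
          rw [pow_succ, ih]; group
      _ = z ^ n.choose 2 * (a ^ n * z ^ n) * a * b ^ n * b := by rw [hpow]; group
      _ = z ^ n.choose 2 * z ^ n * (a ^ n * a) * (b ^ n * b) := by
          rw [← (ha.pow_pow n n).eq]; group
      _ = _ := by
          rw [← pow_add, ← pow_succ, ← pow_succ, Nat.choose_succ_succ' n 1, Nat.choose_one_right,
            add_comm n (n.choose (1 + 1))]

theorem commutator_pow_eq_one_of_commute {a b : X} (hb : Commute ⁅b, a⁆ b)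
    {e : ℕ} (he : Commute (b ^ e) a) : ⁅b, a⁆ ^ e = 1 := by
  have hconj : a * b * a⁻¹ = ⁅b, a⁆⁻¹ * b := by simp only [commutatorElement_def]; group
  have h := congrArg (· ^ e) hconj
  simp only [conj_pow, hb.inv_left.mul_pow] at h
  rw [← he.eq, mul_inv_cancel_right] at h
  have h2 := mul_eq_right.1 h.symm
  rwa [inv_pow, inv_eq_one] at h2

/-- Commutators in `A` are killed by `e`, which divides `m.choose 2`, so the m-th power map is
multiplicative on `A`. It kills `⁅a, l⁆`, the product of a and a conjugate of a⁻¹ by l, because `a ^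
m` commutes with l. -/
theorem pow_eq_one_of_mem_commutator_of_class_two {A M : Subgroup X} (hA : A.Normal) (hAM : A ≤ M)
    {e m : ℕ} (hc : ∀ a ∈ A, ∀ b ∈ A, ∀ l ∈ M, Commute ⁅a, b⁆ l)
    (he : ∀ a ∈ A, ∀ l ∈ M, Commute (a ^ e) l) (hm : e ∣ m) (hm2 : e ∣ m.choose 2) {c : X}
    (hcm : c ∈ ⁅A, M⁆) : c ^ m = 1 := by
  have hmul : ∀ a ∈ A, ∀ b ∈ A, (a * b) ^ m = a ^ m * b ^ m := by
    intro a ha b hb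
    have h1 := hc b hb a ha a (hAM ha)
    have h2 := hc b hb a ha b (hAM hb)
    obtain ⟨t, ht⟩ := hm2
    rw [mul_pow_of_commutator_commute h1 h2, ht, pow_mul,
      commutator_pow_eq_one_of_commute h2 (he b hb a (hAM ha)), one_pow, one_mul]
  let S : Subgroup X :=
    { carrier := {a | a ∈ A ∧ a ^ m = 1}
      one_mem' := ⟨one_mem _, one_pow _⟩
      mul_mem' := fun {a b} ha hb => ⟨mul_mem ha.1 hb.1, by
        rw [hmul a ha.1 b hb.1, ha.2, hb.2, one_mul]⟩
      inv_mem' := fun {a} ha => ⟨inv_mem ha.1, by rw [inv_pow, ha.2, inv_one]⟩ }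
  have hS : ⁅A, M⁆ ≤ S := by
    rw [Subgroup.commutator_le]
    intro a ha l hl
    have h1 : l * a⁻¹ * l⁻¹ ∈ A := hA.conj_mem _ (inv_mem ha) l
    rw [show ⁅a, l⁆ = a * (l * a⁻¹ * l⁻¹) by simp only [commutatorElement_def]; group]
    refine ⟨mul_mem ha h1, ?_⟩
    obtain ⟨t, ht⟩ := hm
    have h2 : Commute (a ^ m) l := by
      rw [ht, pow_mul]; exact (he a ha l hl).pow_left t
    rw [hmul a ha _ h1, conj_pow, inv_pow, ← h2.inv_left.eq, mul_inv_cancel_right, mul_inv_cancel]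
  exact (hS hcm).2

theorem pow_mem_of_mem_commutator {A M T : Subgroup X} [T.Normal] (hA : A.Normal) (hAM : A ≤ M)
    {e m : ℕ} (hc : ⁅⁅A, A⁆, M⁆ ≤ T) (he : ∀ a ∈ A, ∀ l ∈ M, Commute (a ^ e) l) (hm : e ∣ m)
    (hm2 : e ∣ m.choose 2) {c : X} (hcm : c ∈ ⁅A, M⁆) : c ^ m ∈ T := by
  have hsurj := QuotientGroup.mk'_surjective T
  rw [← QuotientGroup.eq_one_iff, ← QuotientGroup.mk'_apply, map_pow]
  refine pow_eq_one_of_mem_commutator_of_class_two (A := A.map (QuotientGroup.mk' T))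
    (M := M.map (QuotientGroup.mk' T)) (hA.map _ hsurj) (Subgroup.map_mono hAM) (e := e) ?_ ?_ hm hm2
    ?_
  · rintro _ ⟨a, ha, rfl⟩ _ ⟨b, hb, rfl⟩ _ ⟨l, hl, rfl⟩
    rw [← commutatorElement_eq_one_iff_commute, ← map_commutatorElement, ← map_commutatorElement]
    exact (QuotientGroup.eq_one_iff _).2 (hc (Subgroup.commutator_mem_commutator
      (Subgroup.commutator_mem_commutator ha hb) hl))
  · rintro _ ⟨a, ha, rfl⟩ _ ⟨l, hl, rfl⟩
    rw [← map_pow]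
    exact (he a ha l hl).map _
  · rw [← Subgroup.map_commutator]
    exact ⟨c, hcm, rfl⟩

end ClassTwo

/-! ### The bounds involving the derived length. -/

section DerivedLength

variable (G : Type*) [Group G]

/-- The derived series of `P(G)`, as subgroups of `χ(G)`. -/
def derivedP : ℕ → Subgroup (Chi G)
  | 0 => P G
  | n + 1 => ⁅derivedP n, derivedP n⁆

variable {G}

theorem derivedP_normal (n : ℕ) : (derivedP G n).Normal := by
  induction n with
  | zero => exact inferInstanceAs (P G).Normal
  | succ n ih => exact Subgroup.commutator_normal _ _

theorem derivedP_le_P (n : ℕ) : derivedP G n ≤ P G := by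
  induction n with
  | zero => exact le_rfl
  | succ n ih =>
    have := derivedP_normal (G := G) n
    exact Subgroup.commutator_le_left _ _ |>.trans ih

theorem map_projLeft_derivedP_le (n : ℕ) :
    (derivedP G n).map (projLeft G) ≤ derivedSeries G (n + 1) := by
  induction n with
  | zero =>
    rw [Subgroup.map_le_iff_le_comap]
    intro x hx
    simpa [commutator_def] using projLeft_mem_commutator_of_mem_P hx
  | succ n ih =>
    rw [derivedP, Subgroup.map_commutator, derivedSeries_succ]
    exact Subgroup.commutator_mono ih ih

theorem derivedP_le_W {n : ℕ} (h : derivedSeries G (n + 1) = ⊥) : derivedP G n ≤ W G := by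
  intro x hx
  have h1 := map_projLeft_derivedP_le n (Subgroup.mem_map_of_mem (projLeft G) hx)
  rw [h, Subgroup.mem_bot] at h1
  exact mem_W.2 ⟨derivedP_le_P n hx, h1⟩

theorem commutator_P_L_pow_eq_one {n m : ℕ} (h : derivedSeries G (n + 1) = ⊥)
    (hm : Monoid.exponent (commutator G) ∣ m)
    (hm2 : Monoid.exponent (commutator G) ∣ m.choose 2) {c : Chi G} (hc : c ∈ ⁅P G, L G⁆) :
    c ^ m ^ n = 1 := by
  have key : ∀ k : ℕ, c ^ m ^ k ∈ ⁅derivedP G k, L G⁆ := by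
    intro k
    induction k with
    | zero => rwa [pow_zero, pow_one]
    | succ k ih =>
      have : ⁅derivedP G (k + 1), L G⁆.Normal :=
        have := derivedP_normal (G := G) (k + 1)
        Subgroup.commutator_normal _ _
      rw [pow_succ, pow_mul]
      refine pow_mem_of_mem_commutator (T := ⁅derivedP G (k + 1), L G⁆) (derivedP_normal k)
        (fun x hx => mem_L_of_mem_P (derivedP_le_P k hx)) le_rfl
        (fun a ha l hl => commute_of_mem_W_of_mem_L (pow_mem_W_of_mem_P (derivedP_le_P k ha)) hl)
        hm hm2 ih
  have hbot : ⁅derivedP G n, L G⁆ = ⊥ := by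
    rw [eq_bot_iff, Subgroup.commutator_le]
    intro x hx l hl
    exact Subgroup.mem_bot.2 ((commutatorElement_eq_one_iff_commute).2
      (commute_of_mem_W_of_mem_L (derivedP_le_W h hx) hl))
  simpa [hbot] using key n

theorem L_eq_closure : L G = Subgroup.closure
    (Set.range fun g : G => ofRight G g * (ofLeft G g)⁻¹) := by
  rw [L]
  congr 2
  funext g
  exact (commute_ofLeft_ofRight g).inv_left.eq

theorem right_mul_inv_left_commutator_mem_P (g k : G) :
    ⁅ofLeft G g, ofRight G k * (ofLeft G k)⁻¹⁆ ∈ P G :=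
  commutator_left_L_le_P (Subgroup.commutator_mem_commutator ⟨g, rfl⟩ (right_mul_inv_left_mem_L k))

theorem commute_quotient {x y : Chi G} (hx : x ∈ P G) (hy : y ∈ L G) :
    Commute (QuotientGroup.mk' ⁅P G, L G⁆ x) (QuotientGroup.mk' ⁅P G, L G⁆ y) := by
  rw [← commutatorElement_eq_one_iff_commute, ← map_commutatorElement]
  exact (QuotientGroup.eq_one_iff _).2 (Subgroup.commutator_mem_commutator hx hy)

theorem pow_mem_commutator_P_L {m : ℕ} (hm : ∀ g h k, ⁅ofLeft G g,
    ⁅ofLeft G h, ofRight G k * (ofLeft G k)⁻¹⁆⁆ ^ m ∈ ⁅P G, L G⁆) {r : Chi G} (hr : r ∈ R G) :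
    r ^ m ∈ ⁅P G, L G⁆ := by
  have hsurj := QuotientGroup.mk'_surjective ⁅P G, L G⁆
  rw [← QuotientGroup.eq_one_iff, ← QuotientGroup.mk'_apply, map_pow]
  refine pow_eq_one_of_mem_commutator_of_central
    (i := (QuotientGroup.mk' ⁅P G, L G⁆).comp (ofLeft G))
    (j := (QuotientGroup.mk' ⁅P G, L G⁆).comp (ofRight G))
    (N := (P G).map (QuotientGroup.mk' ⁅P G, L G⁆)) (Subgroup.Normal.map inferInstance _ hsurj)
    ?_ ?_ ?_ ?_ ?_
  · exact fun g k => ⟨_, right_mul_inv_left_commutator_mem_P g k, by simp [map_commutatorElement]⟩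
  · rintro _ ⟨x, hx, rfl⟩ k
    simpa using commute_quotient hx (right_mul_inv_left_mem_L k)
  · rintro _ ⟨x, hx, rfl⟩ _ ⟨y, hy, rfl⟩
    exact commute_quotient hx (mem_L_of_mem_P hy)
  · intro g h k
    have := (QuotientGroup.eq_one_iff _).2 (hm g h k)
    rw [← QuotientGroup.mk'_apply, map_pow, map_commutatorElement, map_commutatorElement, map_mul,
      map_inv] at this
    exact this
  · rw [R] at hr
    nth_rw 1 [L_eq_closure] at hr
    have h1 := Subgroup.mem_map_of_mem (QuotientGroup.mk' ⁅P G, L G⁆) hr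
    rw [Subgroup.map_commutator, Subgroup.map_commutator, MonoidHom.map_range,
      MonoidHom.map_range, MonoidHom.map_closure, ← Set.range_comp] at h1
    exact h1

theorem commutator_sq_mem_and_pow_mem (g h k : G) :
    ⁅ofLeft G g, ⁅ofLeft G h, ofRight G k * (ofLeft G k)⁻¹⁆⁆ ^ 2 ∈ ⁅P G, L G⁆ ∧
      ∀ n : ℕ, h ^ n = 1 → ⁅ofLeft G h, ofRight G k * (ofLeft G k)⁻¹⁆ ^ n ∈ ⁅P G, L G⁆ := by
  have hsurj := QuotientGroup.mk'_surjective ⁅P G, L G⁆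
  have hnorm : ((P G).map (QuotientGroup.mk' ⁅P G, L G⁆)).Normal :=
    Subgroup.Normal.map inferInstance _ hsurj
  obtain ⟨h1, h2⟩ := commutator_sq_and_pow_of_central
    (i := (QuotientGroup.mk' ⁅P G, L G⁆).comp (ofLeft G))
    (j := (QuotientGroup.mk' ⁅P G, L G⁆).comp (ofRight G))
    (N := (P G).map (QuotientGroup.mk' ⁅P G, L G⁆))
    (fun g => (commute_ofLeft_ofRight g).map (QuotientGroup.mk' ⁅P G, L G⁆))
    (fun g k => ⟨_, right_mul_inv_left_commutator_mem_P g k, by simp [map_commutatorElement]⟩)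
    (by
      rintro _ ⟨x, hx, rfl⟩ k
      simpa using commute_quotient hx (right_mul_inv_left_mem_L k))
    (by
      rintro _ ⟨x, hx, rfl⟩ _ ⟨y, hy, rfl⟩
      exact commute_quotient hx (mem_L_of_mem_P hy)) g h k
  constructor
  · rw [← QuotientGroup.eq_one_iff, ← QuotientGroup.mk'_apply, map_pow, map_commutatorElement,
      map_commutatorElement, map_mul, map_inv]
    exact h1
  · intro n hn
    rw [← QuotientGroup.eq_one_iff, ← QuotientGroup.mk'_apply, map_pow, map_commutatorElement,
      map_mul, map_inv]
    refine (h2 n).symm.trans ?_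
    simp [hn]

theorem sq_mem_commutator_P_L {r : Chi G} (hr : r ∈ R G) : r ^ 2 ∈ ⁅P G, L G⁆ :=
  pow_mem_commutator_P_L (fun g h k => (commutator_sq_mem_and_pow_mem g h k).1) hr

/-- Modulo `[P, L]` the triple commutators have order dividing 2, and also dividing a power of p
because the biderivation is linear in the powers of h. -/
theorem mem_commutator_P_L_of_odd {p : ℕ} (hp : Odd p) (hG : IsPGroup p G) {r : Chi G}
    (hr : r ∈ R G) : r ∈ ⁅P G, L G⁆ := by
  rw [← pow_one r]
  refine pow_mem_commutator_P_L (fun g h k => ?_) hr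
  obtain ⟨a, ha⟩ := hG h
  obtain ⟨h1, h2⟩ := commutator_sq_mem_and_pow_mem g h k
  have h3 := h2 _ ha
  have hx := right_mul_inv_left_commutator_mem_P h k
  generalize ⁅ofLeft G h, ofRight G k * (ofLeft G k)⁻¹⁆ = x at *
  rw [← QuotientGroup.eq_one_iff, ← QuotientGroup.mk'_apply, map_pow, ← orderOf_dvd_iff_pow_eq_one]
    at h1 h3 ⊢
  have h4 : orderOf (QuotientGroup.mk' ⁅P G, L G⁆ ⁅ofLeft G g, x⁆) ∣ p ^ a := by
    have hc := commute_quotient (Subgroup.Normal.conj_mem inferInstance _ hx (ofLeft G g))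
      (mem_L_of_mem_P (inv_mem hx))
    rw [orderOf_dvd_iff_pow_eq_one] at h3 ⊢
    rw [show ⁅ofLeft G g, x⁆ = (ofLeft G g * x * (ofLeft G g)⁻¹) * x⁻¹ from rfl, map_mul,
      hc.mul_pow, map_mul, map_mul, map_inv, map_inv, conj_pow, inv_pow, h3]
    simp
  have hcop : Nat.Coprime 2 (p ^ a) := (Nat.coprime_two_left.2 hp).pow_right a
  exact (Nat.dvd_gcd h1 h4).trans (by rw [hcop.gcd_eq_one])

theorem exponent_eq_zero_or_odd {H : Type*} [Group H] {p : ℕ} (hp2 : Odd p)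
    (hH : IsPGroup p H) : Monoid.exponent H = 0 ∨ Odd (Monoid.exponent H) := by
  by_cases h0 : Monoid.exponent H = 0
  · exact Or.inl h0
  right
  obtain ⟨g, hg⟩ := Nat.Prime.exists_orderOf_eq_pow_factorization_exponent H Nat.prime_two
  obtain ⟨k, hk⟩ := hH g
  have h1 := orderOf_dvd_of_pow_eq_one hk
  have hcop : Nat.Coprime (2 ^ (Monoid.exponent H).factorization 2) (p ^ k) :=
    ((Nat.coprime_two_left.2 hp2).pow_right k).pow_left _
  have h2 := Nat.eq_one_of_dvd_coprimes hcop dvd_rfl (hg ▸ h1)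
  rw [← Nat.not_even_iff_odd, even_iff_two_dvd]
  intro h3
  have h4 := (Nat.prime_two.dvd_iff_one_le_factorization h0).1 h3
  rcases pow_eq_one_iff.1 h2 with h5 | h5 <;> omega

theorem derivedSeries_sub_one_add_one_eq_bot {d : ℕ} (hd : derivedSeries G d = ⊥) :
    derivedSeries G (d - 1 + 1) = ⊥ :=
  eq_bot_iff.2 ((derivedSeries_antitone G (by omega)).trans hd.le)

theorem exponent_R_dvd_two_pow_mul {d : ℕ} (hd : derivedSeries G d = ⊥) :
    Monoid.exponent (R G) ∣ 2 ^ d * Monoid.exponent (commutator G) ^ (d - 1) := by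
  refine Monoid.exponent_dvd_of_forall_pow_eq_one fun r => Subtype.ext ?_
  change (r : Chi G) ^ _ = 1
  -- For d = 0 the bound is 1, and χ(G) is itself trivial.
  rcases d with _ | d
  · have hG : ∀ g : G, g = 1 := fun g => by
      have : g ∈ derivedSeries G 0 := Subgroup.mem_top g
      rwa [hd, Subgroup.mem_bot] at this
    have hr := chi_hom_ext (f := MonoidHom.id (Chi G)) (f' := 1)
      (fun g => by rw [hG g, map_one, map_one, map_one])
      (fun g => by rw [hG g, map_one, map_one, map_one]) r
    have hr' : (r : Chi G) = 1 := hr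
    rw [hr', one_pow]
  -- Regroup as 2 · (2e)^d: the lone 2 moves `R G` into `[P, L]`, and each of the d steps costs 2e,
  -- the doubling making e divide the binomial coefficient.
  · rw [Nat.add_sub_cancel, pow_succ', mul_assoc, ← mul_pow, pow_mul]
    have hchoose : (2 * Monoid.exponent (commutator G)).choose 2 =
        Monoid.exponent (commutator G) * (2 * Monoid.exponent (commutator G) - 1) := by
      rw [Nat.choose_two_right, mul_assoc, Nat.mul_div_cancel_left _ two_pos]
    exact commutator_P_L_pow_eq_one hd (dvd_mul_left _ _) (hchoose ▸ dvd_mul_right _ _)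
      (sq_mem_commutator_P_L r.2)

theorem exponent_R_dvd_pow_of_odd {p d : ℕ} (hp2 : Odd p) (hG : IsPGroup p G)
    (hd : derivedSeries G d = ⊥) :
    Monoid.exponent (R G) ∣ Monoid.exponent (commutator G) ^ (d - 1) := by
  refine Monoid.exponent_dvd_of_forall_pow_eq_one fun r => Subtype.ext ?_
  refine commutator_P_L_pow_eq_one (derivedSeries_sub_one_add_one_eq_bot hd) dvd_rfl ?_
    (mem_commutator_P_L_of_odd hp2 hG r.2)
  -- An odd e divides e(e - 1)/2; for e = 0 the binomial coefficient is 0 too.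
  rcases exponent_eq_zero_or_odd hp2 (hG.to_subgroup (commutator G)) with h | ⟨t, ht⟩
  · simp [h]
  · rw [Nat.choose_two_right, ht, Nat.add_sub_cancel, mul_left_comm,
      Nat.mul_div_cancel_left _ two_pos]
    exact dvd_mul_right _ _

end DerivedLength

end WeakCommutativity

theorem mainTheorem10 {G : Type*} [Group G] {p d : ℕ} (hp : p.Prime) (hG : IsPGroup p G)
    (hd : WeakCommutativity.HasDerivedLength G d) :
    (p = 2 →
      Monoid.exponent (WeakCommutativity.R G) ∣
          Monoid.exponent (commutator G) * Monoid.exponent G ∧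
        Monoid.exponent (WeakCommutativity.R G) ∣
          2 ^ d * Monoid.exponent (commutator G) ^ (d - 1)) ∧
    (2 < p →
      Monoid.exponent (WeakCommutativity.R G) ∣
          Monoid.exponent (commutator G) * Monoid.exponent G ∧
        Monoid.exponent (WeakCommutativity.R G) ∣
          Monoid.exponent (commutator G) ^ (d - 1)) :=
  ⟨fun _ => ⟨WeakCommutativity.exponent_R_dvd_mul G,
      WeakCommutativity.exponent_R_dvd_two_pow_mul hd.1⟩,
    fun h2 => ⟨WeakCommutativity.exponent_R_dvd_mul G,
      WeakCommutativity.exponent_R_dvd_pow_of_odd (hp.odd_of_ne_two h2.ne') hG hd.1⟩⟩
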